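/- For $\alpha\in\mathbb{R}\cup\{\pm\infty\}$, $0<\lambda<1$ and $a,b\ge 0$, put $M_\alpha^\lambda(a,b)=0$ if $ab=0$, and for $a,b>0$ put $$M_\alpha^\lambda(a,b)=\begin{cases}\left((1-\lambda)a^\alpha+\lambda b^\alpha\right)^{1/\alpha} & (\alpha\in\mathbb{R}\setminus\{0\}),\\ a^{1-\lambda}b^\lambda & (\alpha=0),\\ \max\{a,b\} & (\alpha=+\infty),\\ \min\{a,b\} & (\alpha=-\infty).\end{cases}$$ A function $f:\mathbb{R}^m\to[0,+\infty)$ is called strictly $\alpha$-concave if $f((1-\lambda)x+\lambda y)>M_\alpha^\lambda(f(x),f(y))$ for all distinct $x,y\in\mathbb{R}^m$ and all $0<\lambda<1$. **Theorem.** Let $m\ge 1$, and let $\Omega\subset\mathbb{R}^m$ be a convex body, that is, a convex set which is the closure of a nonempty bounded open set. Let $-1/m\le\alpha\le+\infty$ and $\gamma=\alpha/(1+m\alpha)$, where $\gamma$ is read as $-\infty$ if $\alpha=-1/m$ and as $1/m$ if $\alpha=+\infty$. Let $\varphi:\mathbb{R}^m\to[0,+\infty)$ be continuous and strictly $\alpha$-concave.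 Then the function $$G_\Omega(x)=\int_\Omega\varphi(x-y)\,dy,\qquad x\in\mathbb{R}^m,$$ is strictly $\gamma$-concave. -/

import Mathlib

/-- A convex body in `ℝ^m`: a convex set that is the closure of a nonempty bounded open set. -/
def IsConvexBody {m : ℕ} (Ω : Set (EuclideanSpace ℝ (Fin m))) : Prop :=
  Convex ℝ Ω ∧
    ∃ U : Set (EuclideanSpace ℝ (Fin m)),
      U.Nonempty ∧ IsOpen U ∧ Bornology.IsBounded U ∧ Ω = closure U

/-- The weighted power mean `((1 - t) a ^ α + t b ^ α) ^ (1 / α)` of `a, b ≥ 0` for an extended real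
exponent `α`: it is `0` when `a b = 0`; otherwise it is the maximum for `α = +∞`, the minimum for
`α = -∞`, and the weighted geometric mean for `α = 0`. -/
noncomputable def powerMean (α : EReal) (t a b : ℝ) : ℝ :=
  if a * b = 0 then 0
  else if α = ⊤ then max a b
  else if α = ⊥ then min a b
  else if α = 0 then a ^ (1 - t) * b ^ t
  else ((1 - t) * a ^ α.toReal + t * b ^ α.toReal) ^ (1 / α.toReal)

/-- `φ` is a non-negative, strictly `α`-concave function on `ℝ^m`. -/
structure IsStrictlyPowerConcave {m : ℕ} (α : EReal) (φ : EuclideanSpace ℝ (Fin m) → ℝ) :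
    Prop where
  nonneg : ∀ x, 0 ≤ φ x
  powerMean_lt : ∀ x y, x ≠ y → ∀ t : ℝ, 0 < t → t < 1 →
    powerMean α t (φ x) (φ y) < φ ((1 - t) • x + t • y)

/-- The exponent `γ = α / (1 + m α)` for `-1 / m ≤ α ≤ +∞`, which is read as `1 / m` for `α = +∞`
and as `-∞` for `α = -1 / m`. (It is not meant to be used for `α < -1 / m`.) -/
noncomputable def concavityExponent (m : ℕ) (α : EReal) : EReal :=
  if α = ⊤ then ((1 / (m : ℝ) : ℝ) : EReal)
  else if α = ((-1 / (m : ℝ) : ℝ) : EReal) then ⊥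
  else ((α.toReal / (1 + m * α.toReal) : ℝ) : EReal)

/-- The potential `G_Ω(x) = ∫_Ω φ(x - y) dy` with respect to Lebesgue measure. -/
noncomputable def potential {m : ℕ} (Ω : Set (EuclideanSpace ℝ (Fin m)))
    (φ : EuclideanSpace ℝ (Fin m) → ℝ) (x : EuclideanSpace ℝ (Fin m)) : ℝ :=
  ∫ y in Ω, φ (x - y)

open MeasureTheory Set
open scoped Pointwise

/-- The one-dimensional Brunn–Minkowski inequality for compact sets. -/
theorem volume_add_volume_le_volume_add_of_isCompact {K L : Set ℝ} (hK : IsCompact K)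
    (hL : IsCompact L) (hK' : K.Nonempty) (hL' : L.Nonempty) :
    volume K + volume L ≤ volume (K + L) := by
  have ha := hK.sSup_mem hK'
  have hb := hL.sInf_mem hL'
  set a := sSup K
  set b := sInf L
  have hd : AEDisjoint volume ((· + b) '' K) ((a + ·) '' L) := by
    refine measure_mono_null (t := {a + b}) ?_ (by simp)
    rintro _ ⟨⟨x, hx, rfl⟩, ⟨y, hy, hxy⟩⟩
    have h1 : x ≤ a := le_csSup hK.bddAbove hx
    have h2 : b ≤ y := csInf_le hL.bddBelow hy
    simp only [mem_singleton_iff] at hxy ⊢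
    linarith
  have hm : NullMeasurableSet ((a + ·) '' L) volume :=
    (hL.image (continuous_const.add continuous_id)).measurableSet.nullMeasurableSet
  calc volume K + volume L = volume ((· + b) '' K) + volume ((a + ·) '' L) := by
        simp [image_add_right, image_add_left]
    _ = volume ((· + b) '' K ∪ (a + ·) '' L) := (measure_union₀ hm hd).symm
    _ ≤ volume (K + L) := by
        refine measure_mono (union_subset ?_ ?_)
        · rintro _ ⟨x, hx, rfl⟩
          exact add_mem_add hx hb
        · rintro _ ⟨y, hy, rfl⟩
          exact add_mem_add ha hy

/-- The one-dimensional Brunn–Minkowski inequality. -/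
theorem volume_add_volume_le_volume_add {A B : Set ℝ} (hA : MeasurableSet A)
    (hB : MeasurableSet B) (hA' : A.Nonempty) (hB' : B.Nonempty) :
    volume A + volume B ≤ volume (A + B) := by
  obtain ⟨x, hx⟩ := hA'
  obtain ⟨y, hy⟩ := hB'
  rw [hA.measure_eq_iSup_isCompact, hB.measure_eq_iSup_isCompact]
  have key : ∀ K, (K ⊆ A ∧ IsCompact K) → ∀ L, (L ⊆ B ∧ IsCompact L) →
      volume K + volume L ≤ volume (A + B) := by
    rintro K ⟨hKA, hK⟩ L ⟨hLB, hL⟩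
    calc volume K + volume L ≤ volume (insert x K) + volume (insert y L) := by
          gcongr <;> exact subset_insert _ _
      _ ≤ volume (insert x K + insert y L) :=
          volume_add_volume_le_volume_add_of_isCompact (hK.insert x) (hL.insert y)
            (insert_nonempty _ _) (insert_nonempty _ _)
      _ ≤ volume (A + B) := by
          gcongr <;> exact insert_subset ‹_› ‹_›
  have := ENNReal.biSup_add_biSup_le' (p := fun K => K ⊆ A ∧ IsCompact K)
    (q := fun L => L ⊆ B ∧ IsCompact L) ⟨∅, by simp⟩ ⟨∅, by simp⟩ key
  simpa only [iSup_and] using this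

theorem volume_convexCombination_le {A B S : Set ℝ} {t : ℝ} (ht0 : 0 < t) (ht1 : t < 1)
    (hA : MeasurableSet A) (hB : MeasurableSet B) (hA' : A.Nonempty) (hB' : B.Nonempty)
    (hS : ∀ x ∈ A, ∀ y ∈ B, (1 - t) * x + t * y ∈ S) :
    ENNReal.ofReal (1 - t) * volume A + ENNReal.ofReal t * volume B ≤ volume S := by
  have h := volume_add_volume_le_volume_add (hA.const_smul_of_ne_zero (sub_pos.2 ht1).ne')
    (hB.const_smul_of_ne_zero ht0.ne') hA'.smul_set hB'.smul_set
  simp only [Measure.addHaar_smul, Module.finrank_self, pow_one, abs_of_pos ht0,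
    abs_of_pos (sub_pos.2 ht1)] at h
  refine h.trans (measure_mono ?_)
  rintro _ ⟨_, ⟨x, hx, rfl⟩, _, ⟨y, hy, rfl⟩, rfl⟩
  exact hS x hx y hy

/-- The one-dimensional functional inequality for functions with supremum `1`. -/
theorem convexCombination_integral_le {f g h : ℝ → ℝ} {t : ℝ} (ht0 : 0 < t) (ht1 : t < 1)
    (hf : Measurable f) (hg : Measurable g) (fi : Integrable f) (gi : Integrable g)
    (hi : Integrable h) (f0 : ∀ x, 0 ≤ f x) (g0 : ∀ x, 0 ≤ g x) (h0 : ∀ x, 0 ≤ h x)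
    (f1 : ∀ x, f x ≤ 1) (g1 : ∀ x, g x ≤ 1)
    (fs : ∀ s < 1, ∃ x, s < f x) (gs : ∀ s < 1, ∃ x, s < g x)
    (hfg : ∀ x y, min (f x) (g y) ≤ h ((1 - t) * x + t * y)) :
    (1 - t) * (∫ x, f x) + t * (∫ x, g x) ≤ ∫ x, h x := by
  have ht1' : 0 < 1 - t := sub_pos.2 ht1
  have hF0 : 0 ≤ ∫ x, f x := integral_nonneg f0
  have hG0 : 0 ≤ ∫ x, g x := integral_nonneg g0
  rw [← ENNReal.ofReal_le_ofReal_iff (integral_nonneg h0),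
    ENNReal.ofReal_add (by positivity) (by positivity), ENNReal.ofReal_mul ht1'.le,
    ENNReal.ofReal_mul ht0.le,
    ofReal_integral_eq_lintegral_ofReal fi (.of_forall f0),
    ofReal_integral_eq_lintegral_ofReal gi (.of_forall g0),
    ofReal_integral_eq_lintegral_ofReal hi (.of_forall h0),
    lintegral_eq_lintegral_meas_lt _ (.of_forall f0) fi.aemeasurable,
    lintegral_eq_lintegral_meas_lt _ (.of_forall g0) gi.aemeasurable,
    lintegral_eq_lintegral_meas_lt _ (.of_forall h0) hi.aemeasurable]
  have mf : Measurable fun s => volume {a | s < f a} :=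
    Antitone.measurable fun a b hab => measure_mono fun x hx => lt_of_le_of_lt hab hx
  have mg : Measurable fun s => volume {a | s < g a} :=
    Antitone.measurable fun a b hab => measure_mono fun x hx => lt_of_le_of_lt hab hx
  rw [← lintegral_const_mul _ mf, ← lintegral_const_mul _ mg,
    ← lintegral_add_left (mf.const_mul _)]
  refine lintegral_mono fun s => ?_
  rcases lt_or_ge s 1 with hs | hs
  · exact volume_convexCombination_le ht0 ht1 (measurableSet_lt measurable_const hf)
      (measurableSet_lt measurable_const hg) (fs s hs) (gs s hs)
      fun x hx y hy => (lt_min hx hy).trans_le (hfg x y)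
  · have h1 : {a | s < f a} = ∅ := eq_empty_of_forall_notMem fun x hx =>
      (hs.trans_lt hx).not_ge (f1 x)
    have h2 : {a | s < g a} = ∅ := eq_empty_of_forall_notMem fun x hx =>
      (hs.trans_lt hx).not_ge (g1 x)
    simp [h1, h2]

/-- A bounded non-negative measurable function with bounded support. -/
structure IsBoundedDensity {E : Type*} [NormedAddCommGroup E] [MeasurableSpace E]
    (f : E → ℝ) : Prop where
  measurable : Measurable f
  nonneg : ∀ x, 0 ≤ f x
  exists_bound : ∃ C, ∀ x, f x ≤ C
  exists_radius : ∃ R, ∀ x, f x ≠ 0 → ‖x‖ ≤ R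

theorem IsBoundedDensity.integral_le {E : Type*} [NormedAddCommGroup E] [MeasurableSpace E]
    [ProperSpace E] (μ : Measure E) [IsFiniteMeasureOnCompacts μ] [OpensMeasurableSpace E]
    {f : E → ℝ} {C R : ℝ} (hm : Measurable f) (h0 : ∀ x, 0 ≤ f x)
    (hC : ∀ x, f x ≤ C) (hR : ∀ x, f x ≠ 0 → ‖x‖ ≤ R) :
    Integrable f μ ∧ ∫ x, f x ∂μ ≤ C * μ.real (Metric.closedBall 0 R) := by
  have hle : ∀ x, f x ≤ (Metric.closedBall (0 : E) R).indicator (fun _ => C) x := by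
    intro x
    by_cases hx : f x = 0
    · rw [hx]
      exact indicator_nonneg (fun y _ => (h0 y).trans (hC y)) x
    · rw [indicator_of_mem (by simpa using hR x hx)]
      exact hC x
  have hi : Integrable ((Metric.closedBall (0 : E) R).indicator (fun _ => C)) μ := by
    refine IntegrableOn.integrable_indicator ?_ Metric.isClosed_closedBall.measurableSet
    exact integrableOn_const (isCompact_closedBall _ _).measure_lt_top.ne
  have hf : Integrable f μ := hi.mono' hm.aestronglyMeasurable
    (.of_forall fun x => by rw [Real.norm_of_nonneg (h0 x)]; exact hle x)
  refine ⟨hf, (integral_mono hf hi hle).trans_eq ?_⟩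
  rw [integral_indicator Metric.isClosed_closedBall.measurableSet, setIntegral_const,
    smul_eq_mul, mul_comm]

theorem IsBoundedDensity.integrable {E : Type*} [NormedAddCommGroup E] [MeasurableSpace E]
    [ProperSpace E] (μ : Measure E) [IsFiniteMeasureOnCompacts μ] [OpensMeasurableSpace E]
    {f : E → ℝ} (hf : IsBoundedDensity f) : Integrable f μ := by
  obtain ⟨C, hC⟩ := hf.exists_bound
  obtain ⟨R, hR⟩ := hf.exists_radius
  exact (IsBoundedDensity.integral_le μ hf.measurable hf.nonneg hC hR).1

/-- A pair of means `M`, `M'` such that a pointwise inequality with `M` integrates, over the line,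
to an inequality with `M'`. -/
structure IsMeanStep (t : ℝ) (M M' : ℝ → ℝ → ℝ) : Prop where
  nonneg : ∀ a b, 0 ≤ a → 0 ≤ b → 0 ≤ M a b
  mono : ∀ a a' b b', 0 ≤ a → 0 ≤ b → a ≤ a' → b ≤ b' → M a b ≤ M a' b'
  homogeneous : ∀ s a b, 0 ≤ s → 0 ≤ a → 0 ≤ b → M (s * a) (s * b) = s * M a b
  zero_left : ∀ b, M' 0 b = 0
  zero_right : ∀ a, M' a 0 = 0
  hoelder : ∀ a b c d, 0 ≤ a → 0 ≤ b → 0 ≤ c → 0 ≤ d →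
    M' (a * c) (b * d) ≤ M a b * ((1 - t) * c + t * d)

/-- The Borell–Brascamp–Lieb inequality on the line. -/
theorem IsMeanStep.le_integral_real {t : ℝ} {M M' : ℝ → ℝ → ℝ} (hM : IsMeanStep t M M')
    (ht0 : 0 < t) (ht1 : t < 1) {f g h : ℝ → ℝ} (hf : IsBoundedDensity f)
    (hg : IsBoundedDensity g) (hh : IsBoundedDensity h)
    (hfg : ∀ x y, M (f x) (g y) ≤ h ((1 - t) * x + t * y)) :
    M' (∫ x, f x) (∫ x, g x) ≤ ∫ x, h x := by
  have hH0 : 0 ≤ ∫ x, h x := integral_nonneg hh.nonneg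
  have bf : BddAbove (range f) := by
    obtain ⟨C, hC⟩ := hf.exists_bound
    exact ⟨C, by rintro _ ⟨x, rfl⟩; exact hC x⟩
  have bg : BddAbove (range g) := by
    obtain ⟨C, hC⟩ := hg.exists_bound
    exact ⟨C, by rintro _ ⟨x, rfl⟩; exact hC x⟩
  set A := ⨆ x, f x with hA
  set B := ⨆ x, g x with hB
  have hfA : ∀ x, f x ≤ A := le_ciSup bf
  have hgB : ∀ x, g x ≤ B := le_ciSup bg
  rcases ((hf.nonneg 0).trans (hfA 0)).eq_or_lt with hA0 | hA0
  · have : f = fun _ => 0 := funext fun x => le_antisymm ((hfA x).trans_eq hA0.symm) (hf.nonneg x)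
    simpa [this, hM.zero_left] using hH0
  rcases ((hg.nonneg 0).trans (hgB 0)).eq_or_lt with hB0 | hB0
  · have : g = fun _ => 0 := funext fun x => le_antisymm ((hgB x).trans_eq hB0.symm) (hg.nonneg x)
    simpa [this, hM.zero_right] using hH0
  have hF0 : 0 ≤ ∫ x, f x := integral_nonneg hf.nonneg
  have hG0 : 0 ≤ ∫ x, g x := integral_nonneg hg.nonneg
  have key := hM.hoelder A B ((∫ x, f x) / A) ((∫ x, g x) / B) hA0.le hB0.le (by positivity)
    (by positivity)
  rw [mul_div_cancel₀ _ hA0.ne', mul_div_cancel₀ _ hB0.ne'] at key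
  refine key.trans ?_
  rcases (hM.nonneg A B hA0.le hB0.le).eq_or_lt with h0 | h0
  · rwa [← h0, zero_mul]
  have hc := convexCombination_integral_le (f := fun x => f x / A) (g := fun x => g x / B)
    (h := fun x => h x / M A B) ht0 ht1 (hf.measurable.div_const _) (hg.measurable.div_const _)
    ((hf.integrable _).div_const _) ((hg.integrable _).div_const _)
    ((hh.integrable _).div_const _) (fun x => div_nonneg (hf.nonneg x) hA0.le)
    (fun x => div_nonneg (hg.nonneg x) hB0.le) (fun x => div_nonneg (hh.nonneg x) h0.le)
    (fun x => (div_le_one hA0).2 (hfA x)) (fun x => (div_le_one hB0).2 (hgB x))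
    (fun s hs => ?_) (fun s hs => ?_) (fun x y => ?_)
  · simp only [integral_div] at hc
    rwa [le_div_iff₀' h0] at hc
  · obtain ⟨x, hx⟩ := exists_lt_of_lt_ciSup (show s * A < A by nlinarith)
    exact ⟨x, (lt_div_iff₀ hA0).2 hx⟩
  · obtain ⟨x, hx⟩ := exists_lt_of_lt_ciSup (show s * B < B by nlinarith)
    exact ⟨x, (lt_div_iff₀ hB0).2 hx⟩
  · rw [le_div_iff₀ h0]
    have hm : 0 ≤ min (f x / A) (g y / B) :=
      le_min (div_nonneg (hf.nonneg x) hA0.le) (div_nonneg (hg.nonneg y) hB0.le)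
    rw [← hM.homogeneous _ _ _ hm hA0.le hB0.le]
    refine (hM.mono _ _ _ _ (by positivity) (by positivity) ?_ ?_).trans (hfg x y)
    · exact (mul_le_mul_of_nonneg_right (min_le_left _ _) hA0.le).trans_eq
        (div_mul_cancel₀ _ hA0.ne')
    · exact (mul_le_mul_of_nonneg_right (min_le_right _ _) hB0.le).trans_eq
        (div_mul_cancel₀ _ hB0.ne')

theorem integral_fin_succ {n : ℕ} (f : (Fin (n + 1) → ℝ) → ℝ) (hf : Integrable f) :
    ∫ x, f x = ∫ s : ℝ, ∫ y : Fin n → ℝ, f (Fin.cons s y) := by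
  have hp := (volume_preserving_piFinSuccAbove (fun _ : Fin (n + 1) => ℝ) 0).symm
  rw [← hp.integral_comp' f]
  have hi := (hp.integrable_comp_emb (MeasurableEquiv.measurableEmbedding _)).2 hf
  have h2 := integral_prod _ hi
  refine Eq.trans ?_ (h2.trans ?_)
  · rfl
  · simp [MeasurableEquiv.piFinSuccAbove_symm_apply, Fin.insertNthEquiv]

theorem norm_le_norm_cons {n : ℕ} (s : ℝ) (y : Fin n → ℝ) :
    ‖y‖ ≤ ‖(Fin.cons s y : Fin (n + 1) → ℝ)‖ := by
  rw [pi_norm_le_iff_of_nonneg (norm_nonneg _)]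
  intro i
  simpa using norm_le_pi_norm (Fin.cons s y : Fin (n + 1) → ℝ) i.succ

theorem abs_le_norm_cons {n : ℕ} (s : ℝ) (y : Fin n → ℝ) :
    ‖s‖ ≤ ‖(Fin.cons s y : Fin (n + 1) → ℝ)‖ := by
  simpa using norm_le_pi_norm (Fin.cons s y : Fin (n + 1) → ℝ) 0

theorem measurable_fin_cons {n : ℕ} :
    Measurable fun p : ℝ × (Fin n → ℝ) => (Fin.cons p.1 p.2 : Fin (n + 1) → ℝ) := by
  refine measurable_pi_lambda _ fun i => ?_
  refine Fin.cases ?_ (fun j => ?_) i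
  · simpa using measurable_fst
  · simp only [Fin.cons_succ]
    exact (measurable_pi_apply j).comp measurable_snd

theorem IsBoundedDensity.comp_cons {n : ℕ} {f : (Fin (n + 1) → ℝ) → ℝ} (hf : IsBoundedDensity f)
    (s : ℝ) : IsBoundedDensity fun y : Fin n → ℝ => f (Fin.cons s y) := by
  obtain ⟨C, hC⟩ := hf.exists_bound
  obtain ⟨R, hR⟩ := hf.exists_radius
  exact ⟨hf.measurable.comp (measurable_fin_cons.comp (measurable_const.prodMk measurable_id)),
    fun y => hf.nonneg _, ⟨C, fun y => hC _⟩,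
    ⟨R, fun y hy => (norm_le_norm_cons s y).trans (hR _ hy)⟩⟩

theorem IsBoundedDensity.integral_cons {n : ℕ} {f : (Fin (n + 1) → ℝ) → ℝ}
    (hf : IsBoundedDensity f) :
    IsBoundedDensity fun s : ℝ => ∫ y : Fin n → ℝ, f (Fin.cons s y) := by
  obtain ⟨C, hC⟩ := hf.exists_bound
  obtain ⟨R, hR⟩ := hf.exists_radius
  refine ⟨?_, fun s => integral_nonneg fun y => hf.nonneg _, ⟨_, fun s =>
    (IsBoundedDensity.integral_le volume (hf.comp_cons s).measurable (hf.comp_cons s).nonneg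
      (fun y => hC _) (fun y hy => (norm_le_norm_cons s y).trans (hR _ hy))).2⟩, ⟨R, fun s hs => ?_⟩⟩
  · exact ((hf.measurable.comp measurable_fin_cons).stronglyMeasurable.integral_prod_right').measurable
  · obtain ⟨y, hy⟩ : ∃ y : Fin n → ℝ, f (Fin.cons s y) ≠ 0 := by
      by_contra! hy
      exact hs (by simp [hy])
    exact (abs_le_norm_cons s y).trans (hR _ hy)

/-- The Borell–Brascamp–Lieb inequality on `ℝ^n` for a chain of means. -/
theorem le_integral_pi_of_isMeanStep {t : ℝ} (ht0 : 0 < t) (ht1 : t < 1) (M : ℕ → ℝ → ℝ → ℝ)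
    (n : ℕ) (hM : ∀ k < n, IsMeanStep t (M k) (M (k + 1))) {f g h : (Fin n → ℝ) → ℝ}
    (hf : IsBoundedDensity f) (hg : IsBoundedDensity g) (hh : IsBoundedDensity h)
    (hfg : ∀ x y, M 0 (f x) (g y) ≤ h ((1 - t) • x + t • y)) :
    M n (∫ x, f x) (∫ x, g x) ≤ ∫ x, h x := by
  induction n with
  | zero =>
    simp only [Measure.volume_pi_eq_dirac (0 : Fin 0 → ℝ), integral_dirac]
    simpa using hfg 0 0
  | succ n ih =>
    rw [integral_fin_succ f (hf.integrable _), integral_fin_succ g (hg.integrable _),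
      integral_fin_succ h (hh.integrable _)]
    refine (hM n n.lt_succ_self).le_integral_real ht0 ht1 hf.integral_cons hg.integral_cons
      hh.integral_cons fun s s' => ?_
    refine ih (fun k hk => hM k (hk.trans n.lt_succ_self)) (hf.comp_cons s) (hg.comp_cons s')
      (hh.comp_cons _) fun x y => (hfg _ _).trans_eq (congrArg h ?_)
    ext i
    refine Fin.cases ?_ (fun j => ?_) i <;> simp

theorem powerMean_zero_left (α : EReal) (t b : ℝ) : powerMean α t 0 b = 0 := by simp [powerMean]

theorem powerMean_zero_right (α : EReal) (t a : ℝ) : powerMean α t a 0 = 0 := by simp [powerMean]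

theorem powerMean_bot {t a b : ℝ} (ha : 0 < a) (hb : 0 < b) : powerMean ⊥ t a b = min a b := by
  simp [powerMean, ha.ne', hb.ne']

theorem powerMean_zero {t a b : ℝ} (ha : 0 < a) (hb : 0 < b) :
    powerMean 0 t a b = a ^ (1 - t) * b ^ t := by
  simp [powerMean, ha.ne', hb.ne']

theorem powerMean_coe {r t a b : ℝ} (hr : r ≠ 0) (ha : 0 < a) (hb : 0 < b) :
    powerMean (r : EReal) t a b = ((1 - t) * a ^ r + t * b ^ r) ^ (1 / r) := by
  simp [powerMean, ha.ne', hb.ne', hr]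

theorem powerMean_nonneg {α : EReal} {t a b : ℝ} (ht0 : 0 < t) (ht1 : t < 1) (ha : 0 ≤ a)
    (hb : 0 ≤ b) : 0 ≤ powerMean α t a b := by
  have : 0 < 1 - t := sub_pos.2 ht1
  unfold powerMean
  split_ifs <;> positivity

theorem powerMean_mono {r t : ℝ} (hr : r ≤ 0) (ht0 : 0 < t) (ht1 : t < 1) {a a' b b' : ℝ}
    (ha : 0 ≤ a) (hb : 0 ≤ b) (haa : a ≤ a') (hbb : b ≤ b') :
    powerMean r t a b ≤ powerMean r t a' b' := by
  have ht : 0 < 1 - t := sub_pos.2 ht1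
  rcases ha.eq_or_lt with rfl | ha
  · rw [powerMean_zero_left]
    exact powerMean_nonneg ht0 ht1 haa (hb.trans hbb)
  rcases hb.eq_or_lt with rfl | hb
  · rw [powerMean_zero_right]
    exact powerMean_nonneg ht0 ht1 (ha.le.trans haa) hbb
  have ha' := ha.trans_le haa
  have hb' := hb.trans_le hbb
  rcases hr.eq_or_lt with rfl | hr
  · rw [EReal.coe_zero, powerMean_zero ha hb, powerMean_zero ha' hb']
    gcongr
  · rw [powerMean_coe hr.ne ha hb, powerMean_coe hr.ne ha' hb']
    refine Real.rpow_le_rpow_of_nonpos (by positivity) ?_ (by simpa using hr.le)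
    gcongr ?_ * ?_ + ?_ * ?_
    · exact Real.rpow_le_rpow_of_nonpos ha haa hr.le
    · exact Real.rpow_le_rpow_of_nonpos hb hbb hr.le

theorem powerMean_mul {r t : ℝ} (ht0 : 0 < t) (ht1 : t < 1) {s a b : ℝ} (hs : 0 ≤ s)
    (ha : 0 ≤ a) (hb : 0 ≤ b) : powerMean r t (s * a) (s * b) = s * powerMean r t a b := by
  have ht : 0 < 1 - t := sub_pos.2 ht1
  rcases hs.eq_or_lt with rfl | hs
  · simp [powerMean_zero_left]
  rcases ha.eq_or_lt with rfl | ha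
  · simp [powerMean_zero_left]
  rcases hb.eq_or_lt with rfl | hb
  · simp [powerMean_zero_right]
  rcases eq_or_ne r 0 with rfl | hr
  · rw [EReal.coe_zero, powerMean_zero ha hb, powerMean_zero (by positivity) (by positivity),
      Real.mul_rpow hs.le ha.le, Real.mul_rpow hs.le hb.le, mul_mul_mul_comm, ← Real.rpow_add hs,
      sub_add_cancel, Real.rpow_one]
  · rw [powerMean_coe hr ha hb, powerMean_coe hr (by positivity) (by positivity),
      Real.mul_rpow hs.le ha.le, Real.mul_rpow hs.le hb.le,
      show (1 - t) * (s ^ r * a ^ r) + t * (s ^ r * b ^ r) =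
        s ^ r * ((1 - t) * a ^ r + t * b ^ r) by ring,
      Real.mul_rpow (by positivity) (by positivity), ← Real.rpow_mul hs.le, mul_one_div_cancel hr,
      Real.rpow_one]

/-- A weighted two-term Hölder inequality with exponents `r < 0` and `r / (1 + r)`. -/
theorem hoelder_two_of_neg {r t a b c d : ℝ} (hr0 : r < 0) (hr1 : -1 < r) (ht0 : 0 < t)
    (ht1 : t < 1) (ha : 0 < a) (hb : 0 < b) (hc : 0 < c) (hd : 0 < d) :
    (1 - t) * a ^ r + t * b ^ r ≤ ((1 - t) * c + t * d) ^ (-r) *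
      ((1 - t) * (a * c) ^ (r / (1 + r)) + t * (b * d) ^ (r / (1 + r))) ^ (1 + r) := by
  have ht : 0 < 1 - t := sub_pos.2 ht1
  have hr2 : 0 < 1 + r := by linarith
  have hpq : (1 / (-r)).HolderConjugate (1 / (1 + r)) := by
    refine Real.holderConjugate_iff.2 ⟨?_, ?_⟩
    · rw [lt_div_iff₀] <;> linarith
    · simp
  have h := Real.inner_le_Lp_mul_Lq_of_nonneg Finset.univ (f := ![((1 - t) * c) ^ (-r), (t * d) ^ (-r)])
    (g := ![((1 - t) * (a * c) ^ (r / (1 + r))) ^ (1 + r),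
      (t * (b * d) ^ (r / (1 + r))) ^ (1 + r)]) hpq
    (by intro i _; fin_cases i <;> simp <;> positivity)
    (by intro i _; fin_cases i <;> simp <;> positivity)
  have e1 : ∀ x : ℝ, 0 < x → (x ^ (-r)) ^ (1 / (-r)) = x := fun x hx => by
    rw [← Real.rpow_mul hx.le, mul_one_div_cancel (neg_ne_zero.2 hr0.ne), Real.rpow_one]
  have e2 : ∀ x : ℝ, 0 < x → (x ^ (1 + r)) ^ (1 / (1 + r)) = x := fun x hx => by
    rw [← Real.rpow_mul hx.le, mul_one_div_cancel hr2.ne', Real.rpow_one]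
  have e3 : ∀ w x y : ℝ, 0 < w → 0 < x → 0 < y →
      (w * y) ^ (-r) * (w * (x * y) ^ (r / (1 + r))) ^ (1 + r) = w * x ^ r := by
    intro w x y hw hx hy
    rw [Real.mul_rpow hw.le hy.le, Real.mul_rpow hw.le (by positivity),
      ← Real.rpow_mul (by positivity), div_mul_cancel₀ _ hr2.ne', Real.mul_rpow hx.le hy.le,
      Real.rpow_add hw, Real.rpow_one, Real.rpow_neg hw.le, Real.rpow_neg hy.le]
    have := Real.rpow_pos_of_pos hw r
    have := Real.rpow_pos_of_pos hy r
    field_simp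
  simp only [Fin.sum_univ_two, Matrix.cons_val_zero, Matrix.cons_val_one] at h
  rwa [e3 _ _ _ ht ha hc, e3 _ _ _ ht0 hb hd, e1 _ (by positivity), e1 _ (by positivity),
    e2 _ (by positivity), e2 _ (by positivity), one_div_one_div, one_div_one_div] at h

theorem concavityExponent_zero {r : ℝ} (hr : r ≠ 0) : concavityExponent 0 (r : EReal) = r := by
  simp [concavityExponent, hr]

theorem concavityExponent_coe {k : ℕ} {r : ℝ} (h : 0 < 1 + k * r) (hr : r ≠ 0) :
    concavityExponent k (r : EReal) = ((r / (1 + k * r) : ℝ) : EReal) := by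
  have : (r : EReal) ≠ ((-1 / (k : ℝ) : ℝ) : EReal) := by
    rw [Ne, EReal.coe_eq_coe_iff]
    rintro rfl
    rcases eq_or_ne (k : ℝ) 0 with hk | hk
    · simp [hk] at hr
    · rw [mul_div_cancel₀ _ hk] at h
      norm_num at h
  simp [concavityExponent, this]

theorem concavityExponent_coe_zero {k : ℕ} (hk : k ≠ 0) :
    concavityExponent k ((0 : ℝ) : EReal) = ((0 : ℝ) : EReal) := by
  have : (0 : EReal) ≠ ((-1 / (k : ℝ) : ℝ) : EReal) := by
    rw [← EReal.coe_zero, Ne, EReal.coe_eq_coe_iff]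
    exact (div_ne_zero (by norm_num) (by exact_mod_cast hk)).symm
  simp [concavityExponent, this]

theorem powerMean_hoelder {r t a b c d : ℝ} (hr0 : r ≤ 0) (hr1 : -1 ≤ r) (ht0 : 0 < t)
    (ht1 : t < 1) (ha : 0 ≤ a) (hb : 0 ≤ b) (hc : 0 ≤ c) (hd : 0 ≤ d) :
    powerMean (concavityExponent 1 r) t (a * c) (b * d) ≤
      powerMean r t a b * ((1 - t) * c + t * d) := by
  have ht : 0 < 1 - t := sub_pos.2 ht1
  have hn : 0 ≤ powerMean r t a b * ((1 - t) * c + t * d) :=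
    mul_nonneg (powerMean_nonneg ht0 ht1 ha hb) (by positivity)
  rcases ha.eq_or_lt with rfl | ha
  · rwa [zero_mul, powerMean_zero_left]
  rcases hb.eq_or_lt with rfl | hb
  · rwa [zero_mul, powerMean_zero_right]
  rcases hc.eq_or_lt with rfl | hc
  · rwa [mul_zero, powerMean_zero_left]
  rcases hd.eq_or_lt with rfl | hd
  · rwa [mul_zero, powerMean_zero_right]
  rcases hr1.eq_or_lt with rfl | hr1
  · have : concavityExponent 1 ((-1 : ℝ) : EReal) = ⊥ := by simp [concavityExponent]
    rw [this, powerMean_bot (by positivity) (by positivity), powerMean_coe (by norm_num) ha hb]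
    simp only [Real.rpow_neg_one, div_neg, div_one]
    rw [inv_mul_eq_div, le_div_iff₀ (by positivity), mul_add]
    have h1 : min (a * c) (b * d) * ((1 - t) * a⁻¹) ≤ (1 - t) * c := by
      calc _ ≤ (a * c) * ((1 - t) * a⁻¹) := by gcongr; exact min_le_left _ _
        _ = _ := by field_simp
    have h2 : min (a * c) (b * d) * (t * b⁻¹) ≤ t * d := by
      calc _ ≤ (b * d) * (t * b⁻¹) := by gcongr; exact min_le_right _ _
        _ = _ := by field_simp
    linarith
  have hr2 : 0 < 1 + r := by linarith
  rcases hr0.eq_or_lt with rfl | hr0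
  · rw [concavityExponent_coe_zero one_ne_zero, EReal.coe_zero, powerMean_zero ha hb, powerMean_zero (by positivity)
      (by positivity), Real.mul_rpow ha.le hc.le, Real.mul_rpow hb.le hd.le, mul_mul_mul_comm]
    gcongr
    exact Real.geom_mean_le_arith_mean2_weighted ht.le ht0.le hc.le hd.le (by ring)
  · rw [concavityExponent_coe (by simpa using hr2) hr0.ne, Nat.cast_one, one_mul]
    have hq : r / (1 + r) < 0 := div_neg_of_neg_of_pos hr0 hr2
    rw [powerMean_coe hq.ne (by positivity) (by positivity), powerMean_coe hr0.ne ha hb]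
    have h := hoelder_two_of_neg hr0 hr1 ht0 ht1 ha hb hc hd
    set S := (1 - t) * (a * c) ^ (r / (1 + r)) + t * (b * d) ^ (r / (1 + r)) with hS
    have hS0 : 0 < S := by positivity
    set C := (1 - t) * c + t * d with hC
    have hC0 : 0 < C := by positivity
    have h' := Real.rpow_le_rpow_of_nonpos (by positivity) h
      (show 1 / r ≤ 0 by simpa using hr0.le)
    rw [Real.mul_rpow (by positivity) (by positivity), ← Real.rpow_mul hC0.le,
      ← Real.rpow_mul hS0.le, neg_mul, mul_one_div_cancel hr0.ne, Real.rpow_neg_one] at h'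
    rw [one_div_div]
    rw [mul_one_div, inv_mul_le_iff₀ hC0] at h'
    rwa [mul_comm]

theorem isMeanStep_powerMean {r t : ℝ} (hr0 : r ≤ 0) (hr1 : -1 ≤ r) (ht0 : 0 < t) (ht1 : t < 1) :
    IsMeanStep t (powerMean r t) (powerMean (concavityExponent 1 r) t) where
  nonneg _ _ := powerMean_nonneg ht0 ht1
  mono _ _ _ _ := powerMean_mono hr0 ht0 ht1
  homogeneous _ _ _ := powerMean_mul ht0 ht1
  zero_left _ := powerMean_zero_left _ _ _
  zero_right _ := powerMean_zero_right _ _ _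
  hoelder _ _ _ _ := powerMean_hoelder hr0 hr1 ht0 ht1

theorem concavityExponent_succ {k : ℕ} {r : ℝ} (h : 0 < 1 + k * r) :
    concavityExponent 1 ((r / (1 + k * r) : ℝ) : EReal) = concavityExponent (k + 1) r := by
  have h2 : (1 : ℝ) + r / (1 + k * r) = (1 + (k + 1) * r) / (1 + k * r) := by
    rw [eq_div_iff h.ne', add_mul, div_mul_cancel₀ _ h.ne']
    ring
  have hk : (0 : ℝ) < k + 1 := by positivity
  have h1 : r / (1 + k * r) = -1 ↔ r = -1 / (k + 1) := by
    rw [div_eq_iff h.ne', eq_div_iff hk.ne']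
    constructor <;> intro h <;> linarith
  by_cases h3 : r = -1 / (k + 1)
  · have h4 := h1.2 h3
    simp only [concavityExponent, Nat.cast_one, Nat.cast_add, EReal.coe_ne_top, if_false, div_one]
    rw [if_pos (by exact_mod_cast h4), if_pos (by exact_mod_cast h3)]
  · have h4 := mt h1.1 h3
    simp only [concavityExponent, Nat.cast_one, Nat.cast_add, EReal.coe_ne_top, if_false, div_one]
    rw [if_neg (by exact_mod_cast h4), if_neg (by exact_mod_cast h3)]
    rw [EReal.toReal_coe, EReal.toReal_coe, one_mul, h2, div_div_div_cancel_right₀ h.ne']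

/-- The Borell–Brascamp–Lieb inequality on `ℝ^n` for exponents `-1 / n ≤ r ≤ 0`. -/
theorem powerMean_integral_le {n : ℕ} (hn : n ≠ 0) {r t : ℝ} (hr0 : r ≤ 0) (hr1 : -1 ≤ n * r)
    (ht0 : 0 < t) (ht1 : t < 1) {f g h : (Fin n → ℝ) → ℝ}
    (hf : IsBoundedDensity f) (hg : IsBoundedDensity g) (hh : IsBoundedDensity h)
    (hfg : ∀ x y, powerMean r t (f x) (g y) ≤ h ((1 - t) • x + t • y)) :
    powerMean (concavityExponent n r) t (∫ x, f x) (∫ x, g x) ≤ ∫ x, h x := by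
  rcases hr0.eq_or_lt with rfl | hr0
  · rw [concavityExponent_coe_zero hn]
    refine le_integral_pi_of_isMeanStep ht0 ht1 (fun _ => powerMean ((0 : ℝ) : EReal) t) n
      (fun k _ => ?_) hf hg hh hfg
    have := isMeanStep_powerMean le_rfl (by norm_num) ht0 ht1
    rwa [concavityExponent_coe_zero one_ne_zero] at this
  · refine le_integral_pi_of_isMeanStep ht0 ht1 (fun k => powerMean (concavityExponent k r) t) n
      (fun k hk => ?_) hf hg hh (by simpa only [concavityExponent_zero hr0.ne] using hfg)
    have hk' : (k : ℝ) + 1 ≤ n := by exact_mod_cast hk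
    have h1 : -1 ≤ (k + 1) * r := hr1.trans (mul_le_mul_of_nonpos_right hk' hr0.le)
    have h2 : 0 < 1 + k * r := by linarith
    rw [← concavityExponent_succ h2, concavityExponent_coe h2 hr0.ne]
    refine isMeanStep_powerMean (div_nonpos_of_nonpos_of_nonneg hr0.le h2.le) ?_ ht0 ht1
    rw [le_div_iff₀ h2]
    linarith

theorem powerMean_integral_le_euclidean {n : ℕ} (hn : n ≠ 0) {r t : ℝ} (hr0 : r ≤ 0)
    (hr1 : -1 ≤ n * r) (ht0 : 0 < t) (ht1 : t < 1) {f g h : EuclideanSpace ℝ (Fin n) → ℝ}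
    (hf : IsBoundedDensity f) (hg : IsBoundedDensity g) (hh : IsBoundedDensity h)
    (hfg : ∀ x y, powerMean r t (f x) (g y) ≤ h ((1 - t) • x + t • y)) :
    powerMean (concavityExponent n r) t (∫ x, f x) (∫ x, g x) ≤ ∫ x, h x := by
  have hb : ∀ {f : EuclideanSpace ℝ (Fin n) → ℝ}, IsBoundedDensity f →
      IsBoundedDensity fun x : Fin n → ℝ => f (WithLp.toLp 2 x) := by
    intro f hf
    obtain ⟨R, hR⟩ := hf.exists_radius
    refine ⟨hf.measurable.comp (PiLp.volume_preserving_toLp (Fin n)).measurable,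
      fun x => hf.nonneg _, hf.exists_bound.imp fun C hC x => hC _, R, fun x hx => ?_⟩
    refine ((pi_norm_le_iff_of_nonneg (norm_nonneg _)).2 fun i => ?_).trans (hR _ hx)
    exact PiLp.norm_apply_le (WithLp.toLp 2 x) i
  have hi : ∀ f : EuclideanSpace ℝ (Fin n) → ℝ, ∫ x, f x = ∫ x, f (WithLp.toLp 2 x) := fun f =>
    ((PiLp.volume_preserving_toLp (Fin n)).integral_comp
      (MeasurableEquiv.toLp 2 (Fin n → ℝ)).measurableEmbedding f).symm
  rw [hi f, hi g, hi h]
  exact powerMean_integral_le hn hr0 hr1 ht0 ht1 (hb hf) (hb hg) (hb hh) fun x y => hfg _ _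

theorem powerMean_self {r t a : ℝ} (ha : 0 < a) : powerMean r t a a = a := by
  rcases eq_or_ne r 0 with rfl | hr
  · rw [EReal.coe_zero, powerMean_zero ha ha, ← Real.rpow_add ha, sub_add_cancel, Real.rpow_one]
  · rw [powerMean_coe hr ha ha, ← add_mul, sub_add_cancel, one_mul, ← Real.rpow_mul ha.le,
      mul_one_div_cancel hr, Real.rpow_one]

theorem Continuous.powerMean {X : Type*} [TopologicalSpace X] {r t : ℝ} (ht0 : 0 < t)
    (ht1 : t < 1) {f g : X → ℝ} (hf : Continuous f) (hg : Continuous g) (hf0 : ∀ x, 0 < f x)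
    (hg0 : ∀ x, 0 < g x) : Continuous fun x => powerMean r t (f x) (g x) := by
  have ht : 0 < 1 - t := sub_pos.2 ht1
  rcases eq_or_ne r 0 with rfl | hr
  · simp only [EReal.coe_zero, powerMean_zero (hf0 _) (hg0 _)]
    exact (hf.rpow_const fun x => .inl (hf0 x).ne').mul (hg.rpow_const fun x => .inl (hg0 x).ne')
  · simp only [powerMean_coe hr (hf0 _) (hg0 _)]
    refine Continuous.rpow_const ((continuous_const.mul (hf.rpow_const fun x =>
      .inl (hf0 x).ne')).add (continuous_const.mul (hg.rpow_const fun x => .inl (hg0 x).ne')))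
      fun x => .inl ?_
    have := Real.rpow_pos_of_pos (hf0 x) r
    have := Real.rpow_pos_of_pos (hg0 x) r
    positivity

namespace IsStrictlyPowerConcave

variable {m : ℕ} {α : EReal} {φ : EuclideanSpace ℝ (Fin m) → ℝ}

theorem pos (hφ : IsStrictlyPowerConcave α φ) (hm : m ≠ 0) (x : EuclideanSpace ℝ (Fin m)) :
    0 < φ x := by
  have : Nonempty (Fin m) := ⟨⟨0, Nat.pos_of_ne_zero hm⟩⟩
  obtain ⟨v, hv⟩ := exists_ne (0 : EuclideanSpace ℝ (Fin m))
  have h := hφ.powerMean_lt (x - v) (x + v) (fun h => hv ?_) (1 / 2) (by norm_num) (by norm_num)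
  · refine (powerMean_nonneg (by norm_num) (by norm_num) (hφ.nonneg _) (hφ.nonneg _)).trans_lt
      (h.trans_eq (congrArg φ ?_))
    module
  · have h2 : (2 : ℝ) • v = 0 := by
      rw [two_smul, ← sub_eq_zero.2 h.symm]
      abel
    simpa using h2

/-- A function with a positive exponent of strict power concavity on all of `ℝ^m` would be a
positive function, a power of which is concave, hence constant. -/
theorem exponent_le_zero (hφ : IsStrictlyPowerConcave α φ) (hm : m ≠ 0) : α ≤ 0 := by
  by_contra! hα
  have hpos := hφ.pos hm
  have hle : ∀ x y, x ≠ y → φ x ≤ φ y := by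
    intro x y hxy
    have hs : ∀ s : ℝ, 0 < s → s < 1 →
        powerMean α s (φ x) (φ (x + s⁻¹ • (y - x))) < φ y := by
      intro s hs0 hs1
      have hne : x ≠ x + s⁻¹ • (y - x) := by
        simpa [hs0.ne', sub_eq_zero] using hxy.symm
      refine (hφ.powerMean_lt _ _ hne s hs0 hs1).trans_eq (congrArg φ ?_)
      rw [smul_add, smul_inv_smul₀ hs0.ne']
      module
    induction α with
    | bot => simp at hα
    | top =>
      have := hs (1 / 2) (by norm_num) (by norm_num)
      simp only [powerMean, mul_eq_zero, (hpos _).ne', or_self, if_false, if_true] at this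
      exact (le_max_left _ _).trans this.le
    | coe r =>
      have hr : 0 < r := by exact_mod_cast hα
      have hlim : Filter.Tendsto (fun s : ℝ => (1 - s) ^ (1 / r) * φ x) (nhdsWithin 0 (Ioi 0))
          (nhds (φ x)) := by
        have hc : ContinuousAt (fun s : ℝ => (1 - s) ^ (1 / r) * φ x) 0 :=
          (ContinuousAt.rpow_const (by fun_prop) (.inl (by norm_num))).mul continuousAt_const
        have := hc.tendsto.mono_left (nhdsWithin_le_nhds (s := Ioi 0))
        simpa using this
      refine le_of_tendsto hlim ?_
      filter_upwards [Ioo_mem_nhdsGT (zero_lt_one' ℝ)] with s ⟨hs0, hs1⟩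
      refine le_trans ?_ (hs s hs0 hs1).le
      have hs1' : 0 < 1 - s := sub_pos.2 hs1
      have hw := Real.rpow_pos_of_pos (hpos (x + s⁻¹ • (y - x))) r
      have hx := hpos x
      rw [powerMean_coe hr.ne' (hpos _) (hpos _)]
      calc (1 - s) ^ (1 / r) * φ x = ((1 - s) * φ x ^ r) ^ (1 / r) := by
            rw [Real.mul_rpow hs1'.le (by positivity), ← Real.rpow_mul hx.le,
              mul_one_div_cancel hr.ne', Real.rpow_one]
        _ ≤ _ := by
            refine Real.rpow_le_rpow (by positivity) ?_ (by positivity)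
            exact le_add_of_nonneg_right (by positivity)
  have : Nonempty (Fin m) := ⟨⟨0, Nat.pos_of_ne_zero hm⟩⟩
  obtain ⟨v, hv⟩ := exists_ne (0 : EuclideanSpace ℝ (Fin m))
  have heq : ∀ x, φ x = φ 0 := fun x => by
    rcases eq_or_ne x 0 with rfl | hx
    · rfl
    · exact (hle _ _ hx).antisymm (hle _ _ hx.symm)
  have h := hφ.powerMean_lt v 0 hv (1 / 2) (by norm_num) (by norm_num)
  rw [heq v, heq ((1 - 1 / 2 : ℝ) • v + _)] at h
  have h0 := hpos 0
  induction α with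
  | bot => simp at hα
  | top => simp [powerMean, h0.ne'] at h
  | coe r =>
    rw [powerMean_self h0] at h
    exact h.false

end IsStrictlyPowerConcave

theorem IsConvexBody.isCompact {m : ℕ} {Ω : Set (EuclideanSpace ℝ (Fin m))}
    (hΩ : IsConvexBody Ω) : IsCompact Ω := by
  obtain ⟨-, U, -, -, hb, rfl⟩ := hΩ
  exact hb.isCompact_closure

theorem IsCompact.isBoundedDensity_indicator {m : ℕ} {Ω : Set (EuclideanSpace ℝ (Fin m))}
    (hΩ : IsCompact Ω) {φ : EuclideanSpace ℝ (Fin m) → ℝ} (hφ : Continuous φ)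
    (h0 : ∀ x, 0 ≤ φ x) : IsBoundedDensity (Ω.indicator φ) := by
  refine ⟨hφ.measurable.indicator hΩ.measurableSet, indicator_nonneg fun x _ => h0 x, ?_, ?_⟩
  · obtain ⟨C, hC⟩ := hΩ.exists_bound_of_continuousOn hφ.continuousOn
    refine ⟨max C 0, fun x => indicator_apply_le' (fun hx => ?_) fun _ => le_max_right _ _⟩
    exact ((le_abs_self _).trans (hC x hx)).trans (le_max_left _ _)
  · obtain ⟨R, hR⟩ := hΩ.isBounded.exists_norm_le
    exact ⟨R, fun x hx => hR x (mem_of_indicator_ne_zero hx)⟩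

/-- Near the face of `Ω` that is extremal in the direction `y - x`, the strict concavity of `φ`
leaves a uniform gap, since no two points of `Ω` differing by `y - x` combine to a point there. -/
theorem exists_gap {m : ℕ} (hm : m ≠ 0) {Ω : Set (EuclideanSpace ℝ (Fin m))}
    (hΩ : IsCompact Ω) (hne : Ω.Nonempty) {r t : ℝ} (ht0 : 0 < t) (ht1 : t < 1)
    {φ : EuclideanSpace ℝ (Fin m) → ℝ} (hφc : Continuous φ)
    (hφ : IsStrictlyPowerConcave r φ) {x y : EuclideanSpace ℝ (Fin m)} (hxy : x ≠ y) :
    ∃ (τ ε : ℝ) (p : EuclideanSpace ℝ (Fin m)), 0 < ε ∧ p ∈ Ω ∧ τ < inner ℝ (y - x) p ∧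
      ∀ u ∈ Ω, ∀ v ∈ Ω, τ ≤ inner ℝ (y - x) ((1 - t) • u + t • v) →
        powerMean r t (φ (x - u)) (φ (y - v)) + ε ≤
          φ ((1 - t) • x + t • y - ((1 - t) • u + t • v)) := by
  obtain ⟨p, hp, hmax⟩ := hΩ.exists_isMaxOn hne
    (show ContinuousOn (fun w => inner ℝ (y - x) w) Ω by fun_prop)
  have hmax' : ∀ w ∈ Ω, inner ℝ (y - x) w ≤ inner ℝ (y - x) p := hmax
  have hd : 0 < inner ℝ (y - x) (y - x) := by
    rw [real_inner_self_eq_norm_sq]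
    have := norm_pos_iff.2 (sub_ne_zero.2 hxy.symm)
    positivity
  set q : ℝ := inner ℝ (y - x) (y - x) with hq
  have ht : 0 < 1 - t := sub_pos.2 ht1
  set τ : ℝ := inner ℝ (y - x) p - (1 - t) * q / 2 with hτ
  have hτp : τ < inner ℝ (y - x) p := by
    have : 0 < (1 - t) * q := by positivity
    linarith
  set P : Set (EuclideanSpace ℝ (Fin m) × EuclideanSpace ℝ (Fin m)) :=
    (Ω ×ˢ Ω) ∩ {a | τ ≤ inner ℝ (y - x) ((1 - t) • a.1 + t • a.2)} with hP
  have hPc : IsCompact P := (hΩ.prod hΩ).inter_right (isClosed_le continuous_const (by fun_prop))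
  have hpp : (1 - t) • p + t • p = p := by module
  have hPne : P.Nonempty := ⟨(p, p), ⟨hp, hp⟩, by simpa [hpp] using hτp.le⟩
  let D : EuclideanSpace ℝ (Fin m) × EuclideanSpace ℝ (Fin m) → ℝ := fun a =>
    φ ((1 - t) • x + t • y - ((1 - t) • a.1 + t • a.2)) -
      powerMean r t (φ (x - a.1)) (φ (y - a.2))
  have hcont : Continuous D :=
    (hφc.comp (by fun_prop)).sub (Continuous.powerMean ht0 ht1 (hφc.comp (by fun_prop))
      (hφc.comp (by fun_prop)) (fun _ => hφ.pos hm _) fun _ => hφ.pos hm _)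
  obtain ⟨a, ⟨⟨ha1, ha2⟩, ha3⟩, hmin⟩ := hPc.exists_isMinOn hPne hcont.continuousOn
  refine ⟨τ, D a, p, ?_, hp, hτp, fun u hu v hv huv => ?_⟩
  · have hne : x - a.1 ≠ y - a.2 := by
      intro h
      have h2 : a.2 = a.1 + (y - x) := by
        rw [sub_eq_sub_iff_add_eq_add] at h
        rw [add_sub, eq_sub_iff_add_eq, add_comm, h, add_comm]
      have h3 := hmax' _ ha2
      simp only [mem_ofPred_eq, h2, inner_add_right, inner_smul_right, ← hq] at ha3 h3
      have : 0 < (1 - t) * q := by positivity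
      nlinarith
    have := hφ.powerMean_lt _ _ hne t ht0 ht1
    refine sub_pos.2 (this.trans_eq (congrArg φ ?_))
    module
  · have : D a ≤ D (u, v) := hmin (show (u, v) ∈ P from ⟨⟨hu, hv⟩, huv⟩)
    exact le_sub_iff_add_le'.1 this

/-- The convolution of the indicator of a convex body with a strictly `r`-concave function,
`-1 / m ≤ r ≤ 0`, is strictly concave with exponent `concavityExponent m r`. -/
theorem powerMean_potential_lt {m : ℕ} (hm : m ≠ 0) {Ω : Set (EuclideanSpace ℝ (Fin m))}
    (hΩ : IsConvexBody Ω) {r t : ℝ} (hr0 : r ≤ 0) (hr1 : -1 ≤ m * r) (ht0 : 0 < t) (ht1 : t < 1)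
    {φ : EuclideanSpace ℝ (Fin m) → ℝ} (hφc : Continuous φ)
    (hφ : IsStrictlyPowerConcave r φ) {x y : EuclideanSpace ℝ (Fin m)} (hxy : x ≠ y) :
    powerMean (concavityExponent m r) t (potential Ω φ x) (potential Ω φ y) <
      potential Ω φ ((1 - t) • x + t • y) := by
  have hc := hΩ.isCompact
  obtain ⟨hconv, U, hUne, hUo, -, hU⟩ := hΩ
  have hUΩ : U ⊆ Ω := hU ▸ subset_closure
  obtain ⟨τ, ε, p, hε, hp, hτ, hgap⟩ := exists_gap hm hc (hUne.mono hUΩ) ht0 ht1 hφc hφ hxy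
  set z := (1 - t) • x + t • y with hz
  set S : Set (EuclideanSpace ℝ (Fin m)) := Ω ∩ {w | τ ≤ inner ℝ (y - x) w} with hS
  have hSc : IsCompact S := hc.inter_right (isClosed_le continuous_const (by fun_prop))
  have hSpos : 0 < volume.real S := by
    refine ENNReal.toReal_pos ?_ hSc.measure_lt_top.ne
    have ho : IsOpen {w : EuclideanSpace ℝ (Fin m) | τ < inner ℝ (y - x) w} :=
      isOpen_lt continuous_const (by fun_prop)
    have hne : ({w : EuclideanSpace ℝ (Fin m) | τ < inner ℝ (y - x) w} ∩ U).Nonempty :=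
      mem_closure_iff.1 (hU ▸ hp) _ ho hτ
    refine (((ho.inter hUo).measure_pos volume hne).trans_le (measure_mono ?_)).ne'
    exact fun w hw => ⟨hUΩ hw.2, le_of_lt (mem_ofPred_eq ▸ hw.1)⟩
  have hb : ∀ x, IsBoundedDensity (Ω.indicator fun w => φ (x - w)) := fun x =>
    hc.isBoundedDensity_indicator (hφc.comp (by fun_prop)) fun _ => hφ.nonneg _
  have hpot : ∀ x, potential Ω φ x = ∫ w, Ω.indicator (fun w => φ (x - w)) w := fun x =>
    (integral_indicator hc.measurableSet).symm
  have hself : ∀ w : EuclideanSpace ℝ (Fin m), (1 - t) • w + t • w = w := fun w => by module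
  have hεS : ∀ w ∈ S, ε ≤ φ (z - w) := fun w hw => by
    have := hgap w hw.1 w hw.1 (by simpa only [hself, mem_ofPred_eq] using hw.2)
    rw [hself] at this
    exact (le_add_of_nonneg_left
      (powerMean_nonneg ht0 ht1 (hφ.nonneg _) (hφ.nonneg _))).trans this
  set h : EuclideanSpace ℝ (Fin m) → ℝ :=
    fun w => Ω.indicator (fun w => φ (z - w)) w - S.indicator (fun _ => ε) w with hh
  have hle : ∀ w, h w ≤ Ω.indicator (fun w => φ (z - w)) w := fun w =>
    sub_le_self _ (indicator_nonneg (fun _ _ => hε.le) _)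
  have hSi : Integrable (S.indicator fun _ => ε) (volume : Measure (EuclideanSpace ℝ (Fin m))) :=
    (integrableOn_const hSc.measure_lt_top.ne).integrable_indicator hSc.measurableSet
  have hbh : IsBoundedDensity h := by
    have h0 : ∀ w, 0 ≤ h w := fun w => by
      by_cases hw : w ∈ S
      · simpa [hh, hw, hw.1] using hεS w hw
      · simpa [hh, hw] using (hb z).nonneg w
    obtain ⟨C, hC⟩ := (hb z).exists_bound
    obtain ⟨R, hR⟩ := (hb z).exists_radius
    refine ⟨(hb z).measurable.sub (measurable_const.indicator hSc.measurableSet), h0,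
      ⟨C, fun w => (hle w).trans (hC w)⟩, ⟨R, fun w hw => hR w fun hw' => hw ?_⟩⟩
    exact le_antisymm ((hle w).trans_eq hw') (h0 w)
  have hint : ∫ w, h w < potential Ω φ z := by
    rw [hh, integral_sub ((hb z).integrable _) hSi, ← hpot, integral_indicator hSc.measurableSet,
      setIntegral_const, smul_eq_mul]
    exact sub_lt_self _ (by positivity)
  refine lt_of_le_of_lt ?_ hint
  rw [hpot x, hpot y]
  refine powerMean_integral_le_euclidean hm hr0 hr1 ht0 ht1 (hb x) (hb y) hbh fun u v => ?_
  by_cases hu : u ∈ Ω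
  swap
  · rw [indicator_of_notMem hu, powerMean_zero_left]
    exact hbh.nonneg _
  by_cases hv : v ∈ Ω
  swap
  · rw [indicator_of_notMem hv, powerMean_zero_right]
    exact hbh.nonneg _
  have hw : (1 - t) • u + t • v ∈ Ω := hconv hu hv (by linarith) ht0.le (by ring)
  rw [indicator_of_mem hu, indicator_of_mem hv]
  by_cases hwS : (1 - t) • u + t • v ∈ S
  · simpa only [hh, indicator_of_mem hw, indicator_of_mem hwS, le_sub_iff_add_le] using
      hgap u hu v hv hwS.2
  · simp only [hh, indicator_of_mem hw, indicator_of_notMem hwS, sub_zero]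
    rcases eq_or_ne (x - u) (y - v) with he | he
    · have : z - ((1 - t) • u + t • v) = x - u := by
        rw [show z - ((1 - t) • u + t • v) = (1 - t) • (x - u) + t • (y - v) by rw [hz]; module,
          ← he, hself]
      rw [this, ← he]
      exact (powerMean_self (hφ.pos hm _)).le
    · refine (hφ.powerMean_lt _ _ he t ht0 ht1).le.trans_eq (congrArg φ ?_)
      rw [hz]
      module

theorem mainTheorem6 (m : ℕ) (hm : 1 ≤ m)
    (Ω : Set (EuclideanSpace ℝ (Fin m))) (hΩ : IsConvexBody Ω)
    (α : EReal) (hα : ((-1 / (m : ℝ) : ℝ) : EReal) ≤ α)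
    (φ : EuclideanSpace ℝ (Fin m) → ℝ) (hφc : Continuous φ)
    (hφ : IsStrictlyPowerConcave α φ) :
    IsStrictlyPowerConcave (concavityExponent m α) (potential Ω φ) := by
  have hm0 : m ≠ 0 := Nat.one_le_iff_ne_zero.1 hm
  have hα0 := hφ.exponent_le_zero hm0
  refine ⟨fun x => integral_nonneg fun y => hφ.nonneg _, fun x y hxy t ht0 ht1 => ?_⟩
  induction α with
  | bot => exact absurd hα (by simp)
  | top => exact absurd hα0 (by simp)
  | coe r =>
    have hr0 : r ≤ 0 := by exact_mod_cast hα0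
    have hr1 : -1 ≤ m * r := by
      have h : -1 / (m : ℝ) ≤ r := by exact_mod_cast hα
      rwa [div_le_iff₀' (by exact_mod_cast hm)] at h
    exact powerMean_potential_lt hm0 hΩ hr0 hr1 ht0 ht1 hφc hφ hxy
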